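/- Let $G$ be a locally compact topological group with left Haar measure $\mu$, and let $K\ge 1$ be a real number. For $m\in\mathbb{N}$ and $S\subseteq G$ write $S^m=\{s_1\cdots s_m : s_1,\dots,s_m\in S\}$; call $S$ symmetric if $S^{-1}=S$, and precompact if its closure is compact. For real $C\ge 1$, a $C$-approximate group is a symmetric subset $A\subseteq G$ containing the identity such that $A^2$ is covered by at most $C$ left translates of $A$. Suppose $S\subseteq G$ is a precompact symmetric open set containing the identity such that $\mu(S^{2n})\le K\mu(S^n)$ for some integer $n\ge 8K^4$. Then $$\mu(S^{3n})\le\left(2^{12}K^{24}\right)^{10\cdot 5^{4K^4}}\mu(S^n),$$ and $S^{2n}$ is a precompact open $\left(2^{12}K^{24}\right)^{30\cdot 5^{4K^4}}$-approximate group. -/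

import Mathlib

open scoped Pointwise

/-! Put `A = S ^ n`, and let `H` be the set of `h` for which `A ∩ h • A` has at least a proportion
`1 / (2K)` of the measure of `A`. Translates of `A` by elements of `A` all lie in `A * A`, so by
Bonferroni few of them can have small pairwise overlaps; hence at most `2K` left translates of `H`
cover `A` (`exists_cover_popularQuotients`). A path of `S`-steps inside `A` can then be shortened by
jumping to its last visit to each translate. Since `8 * K ≤ n`, iterating this gives `S ^ (4 * n) ⊆
A * H ^ m` with `m` bounded in terms of `K` (`pow_four_mul_subset_of_cover`). Finally, double
counting shows that multiplying by `H` raises packing numbers only by a bounded factor, so boundedly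
many left translates of `A * A = S ^ (2 * n)` cover `S ^ (4 * n)`. Both conclusions follow from this
covering. -/

open MeasureTheory ENNReal in
/-- The elements `h` such that `h • A` meets `A` in at least a proportion `c⁻¹` of `A`. -/
def popularQuotients {G : Type*} [Group G] [MeasurableSpace G] (μ : Measure G) (c : ℝ≥0∞)
    (A : Set G) : Set G :=
  {h | μ A ≤ c * μ (A ∩ h • A)}

/-! ### Maximal families and shortening of paths. -/

section Combinatorics

/-- If finite subsets of `T` whose elements are pairwise `r`-related have bounded size, then a
maximal one of them meets the complement of `r` at every point of `T`. -/
theorem exists_maximal_pairwise_finset {α : Type*} {r : α → α → Prop} (hr : ∀ x y, r x y → r y x)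
    (T : Set α) (N : ℕ)
    (hN : ∀ W : Finset α, ↑W ⊆ T → (W : Set α).Pairwise r → W.card ≤ N) :
    ∃ W : Finset α, ↑W ⊆ T ∧ (W : Set α).Pairwise r ∧ ∀ x ∈ T, ∃ w ∈ W, w = x ∨ ¬ r w x := by
  classical
  let P : ℕ → Prop := fun k => ∃ W : Finset α, ↑W ⊆ T ∧ (W : Set α).Pairwise r ∧ W.card = k
  have hP0 : P 0 := ⟨∅, by simp, by simp, rfl⟩
  obtain ⟨W, hWT, hWr, hWc⟩ := Nat.findGreatest_spec (P := P) (Nat.zero_le N) hP0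
  refine ⟨W, hWT, hWr, fun x hx => ?_⟩
  by_contra! h
  have hxW : x ∉ W := fun hxW => (h x hxW).1 rfl
  have hT : ↑(insert x W) ⊆ T := by
    rw [Finset.coe_insert]
    exact Set.insert_subset hx hWT
  have hpw : ((insert x W : Finset α) : Set α).Pairwise r := by
    rw [Finset.coe_insert]
    exact hWr.insert fun w hw _ => ⟨hr _ _ (h w hw).2, (h w hw).2⟩
  have hcard : (insert x W).card = W.card + 1 := Finset.card_insert_of_notMem hxW
  have hle : (insert x W).card ≤ Nat.findGreatest P N :=
    Nat.le_findGreatest (hN _ hT hpw) ⟨_, hT, hpw, rfl⟩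
  omega

variable {G : Type*} [Group G]

/-- An element of `S ^ m` is the end of a path of `m` steps of `S` starting from `1`. -/
theorem exists_path_of_mem_pow {S : Set G} {m : ℕ} {x : G} (hx : x ∈ S ^ m) :
    ∃ q : ℕ → G, q 0 = 1 ∧ q m = x ∧ (∀ i < m, q (i + 1) ∈ S * {q i}) ∧
      ∀ i ≤ m, q i ∈ S ^ i := by
  induction m generalizing x with
  | zero =>
    rw [pow_zero, Set.mem_one] at hx
    exact ⟨fun _ => 1, rfl, hx.symm, by simp, by simp⟩
  | succ m ih =>
    rw [pow_succ'] at hx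
    obtain ⟨s, hs, y, hy, rfl⟩ := hx
    obtain ⟨q, h0, hm, hstep, hmem⟩ := ih hy
    refine ⟨fun i => if i ≤ m then q i else s * y, by simpa using h0, by simp, ?_, ?_⟩
    · intro i hi
      rcases Nat.lt_succ_iff_lt_or_eq.1 hi with h | rfl
      · simpa [h.le, Nat.succ_le_of_lt h] using hstep i h
      · simpa [hm] using hs
    · intro i hi
      by_cases h : i ≤ m
      · simpa [h] using hmem i h
      · obtain rfl : i = m + 1 := by omega
        simpa [pow_succ'] using Set.mul_mem_mul hs hy

/-- A path of left steps in `S` that stays inside `X * H` ends in `S ^ #X * q 0 * (H * H) ^ #X`. -/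
theorem path_end_mem {S H : Set G} (hS : (1 : G) ∈ S) (hH : (1 : G) ∈ H) (hHinv : H⁻¹ = H)
    (X : Finset G) (m : ℕ) (q : ℕ → G) (hstep : ∀ i < m, q (i + 1) ∈ S * {q i})
    (hcov : ∀ i ≤ m, ∃ x ∈ X, x⁻¹ * q i ∈ H) :
    q m ∈ S ^ X.card * {q 0} * (H * H) ^ X.card := by
  classical
  induction hX : X.card generalizing X m q with
  | zero =>
    obtain ⟨x, hx, -⟩ := hcov 0 (Nat.zero_le _)
    simp [Finset.card_eq_zero.1 hX] at hx
  | succ k ih =>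
    obtain ⟨x, hx, hx0⟩ := hcov 0 (Nat.zero_le _)
    let P : ℕ → Prop := fun i => x⁻¹ * q i ∈ H
    -- Jump to the last visit to `x * H`: it differs from `q 0` by a right factor in `H * H`, and
    -- the later path avoids `x * H`, so `x` can be erased. Leaving costs one step of `S`.
    set i := Nat.findGreatest P m
    have him : i ≤ m := Nat.findGreatest_le m
    have hPi : P i := Nat.findGreatest_spec (P := P) (Nat.zero_le m) hx0
    have hHH : (q 0)⁻¹ * q i ∈ H * H := by
      refine ⟨(x⁻¹ * q 0)⁻¹, ?_, x⁻¹ * q i, hPi, by group⟩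
      rw [← hHinv]
      exact Set.inv_mem_inv.2 hx0
    have h1HH : (1 : G) ∈ H * H := ⟨1, hH, 1, hH, one_mul 1⟩
    rcases him.eq_or_lt with h | h
    · refine ⟨q 0, ⟨1, Set.one_mem_pow hS, q 0, rfl, one_mul _⟩, (q 0)⁻¹ * q m, ?_, by group⟩
      rw [← h, pow_succ]
      exact ⟨1, Set.one_mem_pow h1HH, _, hHH, one_mul _⟩
    · have hcard : (X.erase x).card = k := by
        rw [Finset.card_erase_of_mem hx, hX, Nat.add_sub_cancel]
      have key := ih (X.erase x) (m - (i + 1)) (fun j => q (i + 1 + j))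
        (fun j hj => hstep (i + 1 + j) (by omega))
        (fun j hj => by
          obtain ⟨z, hz, hzj⟩ := hcov (i + 1 + j) (by omega)
          refine ⟨z, Finset.mem_erase.2 ⟨?_, hz⟩, hzj⟩
          rintro rfl
          exact Nat.findGreatest_is_greatest (P := P) (n := m) (k := i + 1 + j) (by omega)
            (by omega) hzj) hcard
      have hm : i + 1 + (m - (i + 1)) = m := by omega
      simp only [hm, add_zero] at key
      obtain ⟨_, ⟨a, ha, _, rfl, rfl⟩, b, hb, hab⟩ := key
      obtain ⟨s, hs, _, rfl, hsq⟩ := hstep i h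
      refine ⟨a * s * q 0, ⟨a * s, ?_, q 0, rfl, rfl⟩, (q 0)⁻¹ * q i * b, ?_, ?_⟩
      · rw [pow_succ]
        exact Set.mul_mem_mul ha hs
      · rw [pow_succ']
        exact Set.mul_mem_mul hHH hb
      · rw [← hab, ← hsq]
        group

/-- If `S ^ n` is covered by few left translates of `H`, then products in `S ^ n` can be
shortened at the expense of a bounded power of `H` on the right. -/
theorem pow_subset_of_cover {S H : Set G} (hS : (1 : G) ∈ S) (hH : (1 : G) ∈ H) (hHinv : H⁻¹ = H)
    (X : Finset G) (n : ℕ) (hcov : ∀ y ∈ S ^ n, ∃ x ∈ X, x⁻¹ * y ∈ H) :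
    S ^ n ⊆ S ^ X.card * (H * H) ^ X.card := by
  intro x hx
  obtain ⟨q, h0, hm, hstep, hmem⟩ := exists_path_of_mem_pow hx
  have := path_end_mem hS hH hHinv X n q hstep
    fun i hi => hcov _ (Set.pow_subset_pow_right hS hi (hmem i hi))
  simpa [h0, hm] using this

theorem pow_four_mul_subset_of_cover {S H : Set G} (hS : (1 : G) ∈ S) (hH : (1 : G) ∈ H)
    (hHinv : H⁻¹ = H) (X : Finset G) (n : ℕ) (hcov : ∀ y ∈ S ^ n, ∃ x ∈ X, x⁻¹ * y ∈ H)
    (hXn : 4 * X.card ≤ n) :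
    S ^ (4 * n) ⊆ S ^ n * H ^ (8 * X.card) := by
  set N := X.card
  have hbase := pow_subset_of_cover hS hH hHinv X n hcov
  -- Shortening frees `n - N` factors of `S`, which can be refilled at the cost of `(H * H) ^ N`.
  -- Four rounds reach `4 * n` because `4 * N ≤ n`.
  have hiter : ∀ j : ℕ, S ^ (n + j * (n - N)) ⊆ S ^ n * ((H * H) ^ N) ^ j := by
    intro j
    induction j with
    | zero => simp
    | succ j ih =>
      have e1 : n + (j + 1) * (n - N) = (n - N) + (n + j * (n - N)) := by ring
      calc S ^ (n + (j + 1) * (n - N)) = S ^ (n - N) * S ^ (n + j * (n - N)) := by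
            rw [e1, pow_add]
        _ ⊆ S ^ (n - N) * (S ^ N * (H * H) ^ N * ((H * H) ^ N) ^ j) :=
            Set.mul_subset_mul_left (ih.trans (Set.mul_subset_mul_right hbase))
        _ = S ^ n * ((H * H) ^ N) ^ (j + 1) := by
            rw [mul_assoc (S ^ N), ← mul_assoc, ← pow_add, ← pow_succ',
              Nat.sub_add_cancel (by omega)]
  calc S ^ (4 * n) ⊆ S ^ (n + 4 * (n - N)) := Set.pow_subset_pow_right hS (by omega)
    _ ⊆ S ^ n * ((H * H) ^ N) ^ 4 := hiter 4
    _ = S ^ n * H ^ (8 * N) := by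
        rw [← pow_two, ← pow_mul, ← pow_mul]
        congr 2
        ring

end Combinatorics

/-! ### Popular quotients: covering and packing. -/

section Measure

open MeasureTheory ENNReal NNReal

/-- Bonferroni's inequality for sets of equal measure with small pairwise intersections. -/
theorem card_mul_le_measureReal_biUnion_add {α ι : Type*} [MeasurableSpace α]
    (μ : Measure α) (s : Finset ι) (f : ι → Set α) (hf : ∀ i, MeasurableSet (f i))
    {a ε : ℝ} (hfin : ∀ i, μ (f i) ≠ ∞) (ha : ∀ i, μ.real (f i) = a)
    (hε : (s : Set ι).Pairwise fun i j => μ.real (f i ∩ f j) ≤ ε) :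
    s.card * a ≤ μ.real (⋃ i ∈ s, f i) + s.card * (s.card - 1) / 2 * ε := by
  classical
  induction s using Finset.induction_on with
  | empty => simp
  | insert i s hi ih =>
    rw [Finset.coe_insert] at hε
    have ih := ih (hε.mono (Set.subset_insert _ _))
    have hU : μ (⋃ j ∈ s, f j) ≠ ∞ :=
      (measure_biUnion_lt_top s.finite_toSet fun j _ => (hfin j).lt_top).ne
    have hunion := measureReal_union_add_inter (μ := μ) (s := f i)
      (Finset.measurableSet_biUnion s fun j _ => hf j) (hfin i) hU
    have hint : μ.real (f i ∩ ⋃ j ∈ s, f j) ≤ s.card * ε := by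
      rw [Set.inter_iUnion₂]
      refine (measureReal_biUnion_finset_le s _).trans ?_
      rw [← nsmul_eq_mul]
      refine Finset.sum_le_card_nsmul _ _ _ fun j hj => ?_
      exact hε (Set.mem_insert _ _) (Set.mem_insert_of_mem _ hj) (by rintro rfl; exact hi hj)
    rw [Finset.set_biUnion_insert, Finset.card_insert_of_notMem hi]
    rw [ha] at hunion
    push_cast
    linarith

variable {G : Type*} [Group G] [MeasurableSpace G]

theorem inv_popularQuotients [MeasurableMul G] (μ : Measure G) [μ.IsMulLeftInvariant] (c : ℝ≥0∞)
    (A : Set G) : (popularQuotients μ c A)⁻¹ = popularQuotients μ c A := by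
  ext h
  have e : μ (A ∩ h⁻¹ • A) = μ (A ∩ h • A) := by
    rw [← measure_smul μ h (A ∩ h⁻¹ • A), Set.smul_set_inter, smul_inv_smul, Set.inter_comm]
  simp only [popularQuotients, Set.mem_inv, Set.mem_ofPred_eq, e]

theorem one_mem_popularQuotients (μ : Measure G) {c : ℝ≥0∞} (hc : 1 ≤ c) (A : Set G) :
    (1 : G) ∈ popularQuotients μ c A := by
  simpa [popularQuotients] using le_mul_of_one_le_left' hc

theorem inv_mul_mem_popularQuotients [MeasurableMul G] (μ : Measure G) [μ.IsMulLeftInvariant]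
    (c : ℝ≥0∞) (A : Set G) (x y : G) :
    x⁻¹ * y ∈ popularQuotients μ c A ↔ μ A ≤ c * μ (x • A ∩ y • A) := by
  have e : μ (A ∩ (x⁻¹ * y) • A) = μ (x • A ∩ y • A) := by
    rw [← measure_smul μ x, Set.smul_set_inter, smul_smul, mul_inv_cancel_left]
  simp [popularQuotients, e]

/-- A set of doubling `k` is covered by at most `2 * k` left translates of its set of popular
quotients. -/
theorem exists_cover_popularQuotients [MeasurableMul G] (μ : Measure G) [μ.IsMulLeftInvariant]
    {A : Set G} (hA : MeasurableSet A) (h0 : μ A ≠ 0) (hfin : μ A ≠ ∞) {k : ℝ≥0} (hk : 1 ≤ k)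
    (hdoubling : μ (A * A) ≤ k * μ A) :
    ∃ X : Finset G, (X.card : ℝ) ≤ 2 * k ∧
      ∀ y ∈ A, ∃ x ∈ X, x⁻¹ * y ∈ popularQuotients μ (2 * k) A := by
  classical
  have hk' : (1 : ℝ) ≤ k := hk
  set H := popularQuotients μ (2 * k) A
  let r : G → G → Prop := fun x y => x⁻¹ * y ∉ H
  have hr : ∀ x y, r x y → r y x := by
    intro x y hxy hyx
    refine hxy ?_
    change x⁻¹ * y ∈ popularQuotients μ (2 * k) A
    rw [← inv_popularQuotients μ, Set.mem_inv, mul_inv_rev, inv_inv]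
    exact hyx
  have hapos : 0 < μ.real A := ENNReal.toReal_pos h0 hfin
  have hfinx : ∀ x : G, μ (x • A) ≠ ∞ := fun x => by rwa [measure_smul]
  have hAA : μ (A * A) ≠ ∞ := (hdoubling.trans_lt (mul_lt_top coe_lt_top hfin.lt_top)).ne
  have hdr : μ.real (A * A) ≤ k * μ.real A := by
    have := ENNReal.toReal_mono (mul_ne_top coe_ne_top hfin) hdoubling
    simpa [measureReal_def] using this
  have hbound : ∀ W : Finset G, ↑W ⊆ A → (W : Set G).Pairwise r →
      ¬ ((2 * k : ℝ) ≤ W.card ∧ (W.card : ℝ) ≤ 2 * k + 1) := by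
    rintro W hWA hWr ⟨h1, h2⟩
    have hB := card_mul_le_measureReal_biUnion_add μ W (fun x => x • A) (a := μ.real A)
      (ε := μ.real A / (2 * k)) (fun x => hA.const_smul x) hfinx
      (fun x => by simp [measureReal_def, measure_smul])
      (fun x hx y hy hxy => by
        have h3 : ¬ μ A ≤ 2 * k * μ (x • A ∩ y • A) := fun h =>
          hWr hx hy hxy ((inv_mul_mem_popularQuotients μ _ A x y).2 h)
        have h4 := ENNReal.toReal_mono hfin (not_le.1 h3).le
        change μ.real (x • A ∩ y • A) ≤ _
        rw [le_div_iff₀ (by positivity), mul_comm]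
        simpa [measureReal_def] using h4)
    have hsub : (⋃ x ∈ W, x • A) ⊆ A * A := by
      refine Set.iUnion₂_subset fun x hx => ?_
      rintro _ ⟨y, hy, rfl⟩
      exact Set.mul_mem_mul (hWA hx) hy
    have hU := (measureReal_mono (μ := μ) hsub hAA).trans hdr
    have h5 : (W.card : ℝ) * μ.real A ≤
        (k + W.card * (W.card - 1) / (4 * k)) * μ.real A := by
      refine hB.trans ((add_le_add_left hU _).trans (le_of_eq ?_))
      field_simp
      ring
    have h6 := le_of_mul_le_mul_right h5 hapos
    have h7 : (W.card : ℝ) * (4 * k) ≤ k * (4 * k) + W.card * (W.card - 1) := by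
      have := mul_le_mul_of_nonneg_right h6 (by positivity : (0 : ℝ) ≤ 4 * k)
      rwa [add_mul, div_mul_cancel₀ _ (by positivity)] at this
    -- With `w = W.card`, `h7` says `w ≤ (w - 2k)²`, but `0 ≤ w - 2k ≤ 1 < w`.
    nlinarith
  have hcard : ∀ W : Finset G, ↑W ⊆ A → (W : Set G).Pairwise r → (W.card : ℝ) ≤ 2 * k := by
    -- Bonferroni is contradictory only for sizes near `2k`, so a larger family is cut down to
    -- `⌈2k⌉` elements.
    intro W hWA hWr
    by_contra! h
    have hle : ⌈(2 * k : ℝ)⌉₊ ≤ W.card := Nat.ceil_le.2 h.le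
    obtain ⟨V, hVW, hV⟩ := Finset.exists_subset_card_eq hle
    refine hbound V ((Finset.coe_subset.2 hVW).trans hWA) (hWr.mono (Finset.coe_subset.2 hVW)) ?_
    rw [hV]
    exact ⟨Nat.le_ceil _, (Nat.ceil_lt_add_one (by positivity)).le⟩
  obtain ⟨W, hWA, hWr, hW⟩ := exists_maximal_pairwise_finset hr A ⌊(2 * k : ℝ)⌋₊
    fun W h h' => Nat.le_floor (hcard W h h')
  refine ⟨W, hcard W hWA hWr, fun y hy => ?_⟩
  obtain ⟨w, hw, rfl | h⟩ := hW y hy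
  · refine ⟨w, hw, ?_⟩
    rw [inv_mul_cancel]
    refine one_mem_popularQuotients μ ?_ A
    have : (1 : ℝ≥0) ≤ 2 * k := hk.trans (le_mul_of_one_le_left' one_le_two)
    exact_mod_cast this
  · exact ⟨w, hw, not_not.1 h⟩

variable [TopologicalSpace G] [IsTopologicalGroup G] [BorelSpace G]

/-- Packing bound: the number of disjoint left translates of `A` by elements of
`g * A * H ^ m`, where `H` is the set of popular quotients of `A`. -/
theorem card_le_of_subset_smul_mul_popularQuotients_pow (μ : Measure G) [μ.IsMulLeftInvariant]
    {A : Set G} (hA : IsOpen A) (hAinv : A⁻¹ = A) (h0 : μ A ≠ 0) (hfin : μ A ≠ ∞) {k c : ℝ≥0∞}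
    (hdoubling : μ (A * A) ≤ k * μ A) (m : ℕ) (g : G) (W : Finset G)
    (hW : ↑W ⊆ g • (A * popularQuotients μ c A ^ m))
    (hdisj : (W : Set G).Pairwise fun x y => Disjoint (x • A) (y • A)) :
    (W.card : ℝ≥0∞) ≤ k * (c * k) ^ m := by
  classical
  set H := popularQuotients μ c A
  induction m generalizing g W with
  | zero =>
    rw [pow_zero, mul_one] at hW ⊢
    refine (ENNReal.mul_le_mul_iff_left h0 hfin).1 ?_
    calc (W.card : ℝ≥0∞) * μ A = ∑ w ∈ W, μ (w • A) := by simp [measure_smul]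
      _ = μ (⋃ w ∈ W, w • A) :=
          (measure_biUnion_finset hdisj fun w _ => (hA.smul w).measurableSet).symm
      _ ≤ μ (g • (A * A)) := by
          refine measure_mono (Set.iUnion₂_subset fun w hw => ?_)
          rw [← smul_mul_assoc]
          rintro _ ⟨y, hy, rfl⟩
          exact Set.mul_mem_mul (hW hw) hy
      _ ≤ k * μ A := by rwa [measure_smul]
  | succ m ih =>
    set B := A * H ^ m
    have hBopen : IsOpen B := hA.mul_right
    -- Each `E w` has measure at least `μ A / c`: for `w = g * a * h * t` it contains `(g * a) • (A
    -- ∩ h • A)`. Conversely `u ∈ E w` forces `w ∈ u • B`, so the induction hypothesis, with `u` as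
    -- base point, bounds how many `E w` contain `u`.
    let E : G → Set G := fun w => g • (A * A) ∩ w • B⁻¹
    have hEmeas : ∀ w, MeasurableSet (E w) := fun w =>
      ((hA.mul_right.smul g).inter (hBopen.inv.smul w)).measurableSet
    have hlower : ∀ w ∈ W, μ A ≤ c * μ (E w) := by
      intro w hw
      obtain ⟨_, ⟨a, ha, z, hz, rfl⟩, rfl⟩ := hW hw
      rw [pow_succ'] at hz
      obtain ⟨h, hh, t, ht, rfl⟩ := hz
      have hh' : μ A ≤ c * μ (A ∩ h • A) := hh
      refine hh'.trans (mul_le_mul_right ?_ c)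
      rw [← measure_smul μ (g * a) (A ∩ h • A)]
      refine measure_mono ?_
      rintro _ ⟨b, ⟨hb, b', hb', hbb⟩, rfl⟩
      refine ⟨⟨a * b, Set.mul_mem_mul ha hb, by simp [mul_assoc]⟩, (b'⁻¹ * t)⁻¹, ?_, ?_⟩
      · refine Set.inv_mem_inv.2 (Set.mul_mem_mul ?_ ht)
        rw [← hAinv]
        exact Set.inv_mem_inv.2 hb'
      · simp only [smul_eq_mul] at hbb ⊢
        rw [← hbb]
        group
    have hupper : ∑ w ∈ W, μ (E w) ≤ k * (c * k) ^ m * (k * μ A) := by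
      calc ∑ w ∈ W, μ (E w) = ∑ w ∈ W, ∫⁻ u, (E w).indicator 1 u ∂μ := by
            simp [hEmeas]
        _ = ∫⁻ u, ∑ w ∈ W, (E w).indicator 1 u ∂μ :=
            (lintegral_finsetSum _ fun w _ => measurable_one.indicator (hEmeas w)).symm
        _ ≤ ∫⁻ u, (g • (A * A)).indicator (fun _ => k * (c * k) ^ m) u ∂μ := by
            refine lintegral_mono fun u => ?_
            by_cases hu : u ∈ g • (A * A)
            · have hsum : ∑ w ∈ W, (E w).indicator (1 : G → ℝ≥0∞) u =
                  ((W.filter fun w => u ∈ E w).card : ℝ≥0∞) := by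
                rw [Finset.natCast_card_filter]
                refine Finset.sum_congr rfl fun w _ => ?_
                by_cases h : u ∈ E w <;> simp [h]
              simp only [hsum, Set.indicator_of_mem hu]
              refine ih u _ (hdisj.mono (Finset.coe_subset.2 (Finset.filter_subset _ _))) ?_
              intro w hw
              obtain ⟨-, b, hb, rfl⟩ := (Finset.mem_filter.1 hw).2
              exact ⟨b⁻¹, hb, by simp⟩
            · have : ∀ w, u ∉ E w := fun w hw => hu hw.1
              simp [this]
        _ ≤ k * (c * k) ^ m * (k * μ A) := by
            rw [lintegral_indicator_const (hA.mul_right.smul g).measurableSet, measure_smul]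
            exact mul_le_mul_right hdoubling _
    refine (ENNReal.mul_le_mul_iff_left h0 hfin).1 ?_
    calc (W.card : ℝ≥0∞) * μ A = ∑ w ∈ W, μ A := by simp
      _ ≤ ∑ w ∈ W, c * μ (E w) := Finset.sum_le_sum hlower
      _ = c * ∑ w ∈ W, μ (E w) := by rw [Finset.mul_sum]
      _ ≤ c * (k * (c * k) ^ m * (k * μ A)) := mul_le_mul_right hupper c
      _ = k * (c * k) ^ (m + 1) * μ A := by ring

/-- Ruzsa covering: in a maximal family of disjoint translates `w • A`, every further `x • A` meets
some `w • A`, whence `x ∈ w • (A * A⁻¹)`. -/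
theorem exists_finset_mul_popularQuotients_pow_subset (μ : Measure G) [μ.IsMulLeftInvariant]
    {A : Set G} (hA : IsOpen A) (hAinv : A⁻¹ = A) (h0 : μ A ≠ 0) (hfin : μ A ≠ ∞) {k c : ℝ≥0}
    (hdoubling : μ (A * A) ≤ k * μ A) (m : ℕ) :
    ∃ W : Finset G, (W.card : ℝ) ≤ k * (c * k) ^ m ∧
      A * popularQuotients μ c A ^ m ⊆ ⋃ w ∈ W, w • (A * A) := by
  have hne : A.Nonempty := by
    rw [Set.nonempty_iff_ne_empty]
    rintro rfl
    simp at h0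
  have hcard : ∀ W : Finset G, ↑W ⊆ A * popularQuotients μ c A ^ m →
      (W : Set G).Pairwise (fun x y => Disjoint (x • A) (y • A)) →
      (W.card : ℝ) ≤ k * (c * k) ^ m := by
    intro W hW hdisj
    have := card_le_of_subset_smul_mul_popularQuotients_pow μ hA hAinv h0 hfin hdoubling m 1 W
      (by rwa [one_smul]) hdisj
    exact_mod_cast this
  obtain ⟨W, hW, hdisj, hmax⟩ := exists_maximal_pairwise_finset
    (r := fun x y : G => Disjoint (x • A) (y • A)) (fun _ _ h => h.symm) _
    ⌊(k * (c * k) ^ m : ℝ)⌋₊ fun W h h' => Nat.le_floor (hcard W h h')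
  refine ⟨W, hcard W hW hdisj, fun x hx => ?_⟩
  obtain ⟨w, hw, hwx⟩ := hmax x hx
  have hmeet : ¬ Disjoint (w • A) (x • A) := by
    rcases hwx with rfl | h
    · rw [disjoint_self]
      exact hne.smul_set.ne_empty
    · exact h
  obtain ⟨_, ⟨a, ha, rfl⟩, b, hb, hab⟩ := Set.not_disjoint_iff.1 hmeet
  refine Set.mem_iUnion₂.2 ⟨w, hw, a * b⁻¹, Set.mul_mem_mul ha ?_, ?_⟩
  · rw [← hAinv]
    exact Set.inv_mem_inv.2 hb
  · simp only [smul_eq_mul] at hab ⊢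
    rw [← mul_assoc, ← hab, mul_inv_cancel_right]

end Measure

/-! ### Topology of powers, numerical bounds and conclusion. -/

theorem isOpen_pow_of_ne_zero {G : Type*} [Group G] [TopologicalSpace G] [IsTopologicalGroup G]
    {S : Set G} (hS : IsOpen S) {m : ℕ} (hm : m ≠ 0) : IsOpen (S ^ m) := by
  obtain ⟨m, rfl⟩ := Nat.exists_eq_succ_of_ne_zero hm
  rw [pow_succ]
  exact hS.mul_left

theorem isCompact_closure_pow {G : Type*} [Group G] [TopologicalSpace G] [IsTopologicalGroup G]
    {S : Set G} (hS : IsCompact (closure S)) (m : ℕ) : IsCompact (closure (S ^ m)) := by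
  have hm : IsCompact (closure S ^ m) := by
    induction m with
    | zero => simp
    | succ m ih =>
      rw [pow_succ]
      exact ih.mul hS
  exact hm.closure_of_subset (Set.pow_subset_pow_left subset_closure)

theorem mul_pow_le_rpow_of_le {K : ℝ} (hK : 1 ≤ K) {N : ℕ} (hN : (N : ℝ) ≤ 2 * K) {d : ℝ}
    (hd : 10 ≤ d) :
    K ^ 2 * (2 * K * K) ^ (8 * N) ≤
      ((2 : ℝ) ^ 12 * K ^ 24) ^ (d * (5 : ℝ) ^ ((4 : ℝ) * K ^ 4)) := by
  have hK0 : 0 < K := one_pos.trans_le hK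
  set b : ℝ := (2 : ℝ) ^ 12 * K ^ 24
  have hK24 : ∀ j : ℕ, 1 ≤ K ^ j := fun j => one_le_pow₀ hK
  have h2b : 2 * K * K ≤ b := by
    have : K * K ≤ K ^ 24 := by
      rw [← pow_two]
      exact pow_le_pow_right₀ hK (by norm_num)
    nlinarith [hK24 24]
  have hKb : K ^ 2 ≤ b := by nlinarith
  have hb1 : 1 ≤ b := (hK24 2).trans hKb
  have hKK : K ≤ K ^ 4 := le_self_pow₀ hK (by norm_num)
  -- Bernoulli suffices, since the exponent needed is only `1 + 8 * N ≤ 1 + 16 * K`.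
  have h5 : 1 + (4 * K ^ 4) * 4 ≤ (5 : ℝ) ^ ((4 : ℝ) * K ^ 4) := by
    have := one_add_mul_self_le_rpow_one_add (s := 4) (p := 4 * K ^ 4) (by norm_num)
      (by nlinarith)
    norm_num at this ⊢
    linarith
  calc K ^ 2 * (2 * K * K) ^ (8 * N) ≤ b * b ^ (8 * N) := by gcongr
    _ = b ^ ((1 + 8 * N : ℕ) : ℝ) := by rw [Real.rpow_natCast, pow_add, pow_one]
    _ ≤ b ^ (d * (5 : ℝ) ^ ((4 : ℝ) * K ^ 4)) := by
        refine Real.rpow_le_rpow_of_exponent_le hb1 ?_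
        push_cast
        nlinarith

/-- `IsApproximateSubgroup C A` is Mathlib's notion of a `C`-approximate group: `1 ∈ A`,
`A⁻¹ = A`, and `A ^ 2` is covered by at most `C` left translates of `A`.
Powers of sets are product sets, and `IsHaarMeasure` refers to left Haar measures. -/
theorem mainTheorem1 {G : Type*} [Group G] [TopologicalSpace G] [IsTopologicalGroup G]
    [LocallyCompactSpace G] [MeasurableSpace G] [BorelSpace G]
    (μ : MeasureTheory.Measure G) [μ.IsHaarMeasure]
    (K : ℝ) (hK : 1 ≤ K)
    (S : Set G) (hS_open : IsOpen S) (hS_precompact : IsCompact (closure S))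
    (hS_symm : S⁻¹ = S) (hS_one : (1 : G) ∈ S)
    (n : ℕ) (hn : 8 * K ^ 4 ≤ (n : ℝ))
    (hdoubling : μ (S ^ (2 * n)) ≤ ENNReal.ofReal K * μ (S ^ n)) :
    μ (S ^ (3 * n)) ≤
        ENNReal.ofReal (((2 : ℝ) ^ 12 * K ^ 24) ^ ((10 : ℝ) * (5 : ℝ) ^ ((4 : ℝ) * K ^ 4))) *
          μ (S ^ n) ∧
      IsOpen (S ^ (2 * n)) ∧
      IsCompact (closure (S ^ (2 * n))) ∧
      IsApproximateSubgroup
        (((2 : ℝ) ^ 12 * K ^ 24) ^ ((30 : ℝ) * (5 : ℝ) ^ ((4 : ℝ) * K ^ 4))) (S ^ (2 * n)) := by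
  set k : NNReal := K.toNNReal
  have hkK : (k : ℝ) = K := Real.coe_toNNReal K (by linarith)
  have hk1 : 1 ≤ k := by
    rw [← NNReal.coe_le_coe, hkK]
    exact hK
  have hK4 : K ≤ K ^ 4 := le_self_pow₀ hK (by norm_num)
  have hn0 : n ≠ 0 := by
    rintro rfl
    norm_num at hn
    linarith
  have hopen : ∀ m, m ≠ 0 → IsOpen (S ^ m) := fun m hm => isOpen_pow_of_ne_zero hS_open hm
  have hinv : ∀ m, (S ^ m)⁻¹ = S ^ m := fun m => by rw [← inv_pow, hS_symm]
  have h0 : μ (S ^ n) ≠ 0 :=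
    ((hopen n hn0).measure_pos μ ⟨1, Set.one_mem_pow hS_one⟩).ne'
  have hfin : μ (S ^ n) ≠ ⊤ :=
    ((MeasureTheory.measure_mono subset_closure).trans_lt
      (isCompact_closure_pow hS_precompact n).measure_lt_top).ne
  have hsq : S ^ n * S ^ n = S ^ (2 * n) := by rw [← pow_add, two_mul]
  have hdbl : μ (S ^ n * S ^ n) ≤ k * μ (S ^ n) := by
    rw [hsq]
    exact hdoubling
  obtain ⟨X, hXcard, hX⟩ := exists_cover_popularQuotients μ (hopen n hn0).measurableSet h0 hfin
    hk1 hdbl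
  have h2k : (1 : ENNReal) ≤ 2 * k := by
    have : (1 : NNReal) ≤ 2 * k := hk1.trans (le_mul_of_one_le_left' one_le_two)
    exact_mod_cast this
  rw [hkK] at hXcard
  -- `4 * X.card ≤ 8 * K ≤ 8 * K ^ 4 ≤ n`.
  have hXn : 4 * X.card ≤ n := by
    have : (4 * X.card : ℝ) ≤ n := by linarith
    exact_mod_cast this
  have hsub := pow_four_mul_subset_of_cover hS_one (one_mem_popularQuotients μ h2k (S ^ n))
    (inv_popularQuotients μ _ _) X n hX hXn
  obtain ⟨W, hWcard, hW⟩ := exists_finset_mul_popularQuotients_pow_subset μ (hopen n hn0) (hinv n)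
    h0 hfin (c := 2 * k) hdbl (8 * X.card)
  rw [hsq] at hW
  push_cast at hWcard hW
  rw [hkK] at hWcard
  have hcov : S ^ (4 * n) ⊆ ⋃ w ∈ W, w • S ^ (2 * n) := hsub.trans hW
  refine ⟨?_, hopen _ (by omega), isCompact_closure_pow hS_precompact _,
    Set.one_mem_pow hS_one, hinv _, W, ?_, ?_⟩
  · calc μ (S ^ (3 * n)) ≤ μ (⋃ w ∈ W, w • S ^ (2 * n)) :=
          MeasureTheory.measure_mono
            ((Set.pow_subset_pow_right hS_one (by omega)).trans hcov)
      _ ≤ ∑ w ∈ W, μ (w • S ^ (2 * n)) := MeasureTheory.measure_biUnion_finset_le _ _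
      _ = W.card * μ (S ^ (2 * n)) := by simp [MeasureTheory.measure_smul]
      _ ≤ W.card * (ENNReal.ofReal K * μ (S ^ n)) := mul_le_mul_right hdoubling _
      _ = ENNReal.ofReal (W.card * K) * μ (S ^ n) := by
          rw [ENNReal.ofReal_mul (by positivity), ENNReal.ofReal_natCast, mul_assoc]
      _ ≤ _ := by
          refine mul_le_mul_left (ENNReal.ofReal_le_ofReal ?_) _
          refine le_trans ?_ (mul_pow_le_rpow_of_le hK hXcard le_rfl)
          -- One `K` comes from the packing bound, the other from passing from `S ^ (2 * n)` to `S ^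
          -- n`.
          calc (W.card : ℝ) * K ≤ K * (2 * K * K) ^ (8 * X.card) * K := by gcongr
            _ = K ^ 2 * (2 * K * K) ^ (8 * X.card) := by ring
  · refine le_trans (hWcard.trans ?_) (mul_pow_le_rpow_of_le hK hXcard (by norm_num))
    gcongr
    exact le_self_pow₀ hK (by norm_num)
  · rw [← pow_mul, show 2 * n * 2 = 4 * n by ring]
    intro x hx
    obtain ⟨w, hw, y, hy, rfl⟩ := Set.mem_iUnion₂.1 (hcov hx)
    exact Set.smul_mem_smul (Finset.mem_coe.2 hw) hy
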